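/- Let $0\le N_0<N_1<N_2<\cdots$ be integers, let $X$ be a random vector in $\mathbb R^d$ with mean $\mu=\mathbb E[X]$, and let $X_1,X_2,\dots$ be i.i.d. copies of $X$, with $S_0=0$ and $S_n=X_1+\cdots+X_n$. Let $\mathscr R\subseteq[0,\infty)\times\mathbb R^d$ be a Borel set, with closure $\overline{\mathscr R}$ and boundary $\partial\mathscr R$, and define $$\boldsymbol N=\inf\{n\in\{N_1,N_2,\dots\}:(n,S_n)\notin\mathscr R\},\qquad \boldsymbol M=\sup\{N_\ell:\ \ell\ge 0,\ \boldsymbol N>N_\ell\}$$ with values in $[0,\infty]$ (and $\inf\emptyset=\infty$). Assume: (I) $\lambda>0$ and $K$ are real numbers with $N_{\ell+1}\le\lambda N_\ell+K$ for all $\ell\ge0$; (II) $\limsup_{\ell\to\infty}(N_{\ell+1}-N_\ell)<\infty$ or $\liminf_{\ell\to\infty}N_{\ell+1}/N_\ell>1$; (III) $\overline{\mathscr R}$ is convex and contains $(0,\boldsymbol 0_d)$; (IV) $(N_0,S_{N_0})\in\overline{\mathscr R}$ almost surely; (V) there is a unique $m>0$ with $(m,m\mu)\in\partial\mathscr R$;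 (VI) $\mathbb E[|X|^3]<\infty$ in every coordinate. For a vector $v\in\mathbb R^d$ let $v^+$ and $v^-$ be the vectors of the coordinatewise positive and negative parts $\max(0,v_i)$ and $\max(0,-v_i)$. Put $$\alpha=\mu-\lambda\,\mathbb E[(X-\mu)^+],\quad \beta=\mu+\lambda\,\mathbb E[(X-\mu)^-],\quad \zeta=(N_0-K)\,\mathbb E[(X-\mu)^+],\quad \eta=(K-N_0)\,\mathbb E[(X-\mu)^-],$$ and $\mathscr D=\{(t,s)\in\overline{\mathscr R}:\ t\alpha+\zeta\le s\le t\beta+\eta\}$, with coordinatewise inequalities. Then $\mathscr D$ is convex, $$\mathbb E[\boldsymbol M]\ \le\ \sup_{(t,s)\in\mathscr D}t\quad\text{in }[0,\infty],$$ this supremum is an attained maximum whenever $t$ is bounded above on $\mathscr D$ (in particular $\mathscr D\neq\emptyset$), and $\mathbb E[\boldsymbol N]\le\lambda\,\mathbb E[\boldsymbol M]+K$. -/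

import Mathlib

open MeasureTheory ProbabilityTheory Filter
open scoped ENNReal

noncomputable section

namespace GeomStop

variable {Ω : Type*} {d : ℕ}

/-- The partial sum `S_n`. The sample `X_{i+1}` is stored as `Xs i`, and `S_0 = 0`. -/
def partialSum (Xs : ℕ → Ω → (Fin d → ℝ)) (n : ℕ) (ω : Ω) : Fin d → ℝ :=
  ∑ i ∈ Finset.range n, Xs i ω

/-- The stopping time: the first `n` in the grid `{N_1, N_2, …}` (without `N_0`) for which
`(n, S_n)` is outside the continuity region `R`; it is `⊤` if there is no such `n`. -/
def stopTime (R : Set (ℝ × (Fin d → ℝ))) (N : ℕ → ℕ) (Xs : ℕ → Ω → (Fin d → ℝ))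
    (ω : Ω) : ℕ∞ :=
  sInf {n : ℕ∞ | ∃ l : ℕ, 1 ≤ l ∧ n = (N l : ℕ∞) ∧
    (((N l : ℕ) : ℝ), partialSum Xs (N l) ω) ∉ R}

/-- The supremum of the grid points `N_0, N_1, …` that are smaller than the stopping time;
it is `⊤` if the stopping time is. -/
def lastTime (R : Set (ℝ × (Fin d → ℝ))) (N : ℕ → ℕ) (Xs : ℕ → Ω → (Fin d → ℝ))
    (ω : Ω) : ℕ∞ :=
  sSup {n : ℕ∞ | ∃ l : ℕ, n = (N l : ℕ∞) ∧ (N l : ℕ∞) < stopTime R N Xs ω}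

variable [MeasurableSpace Ω]

/-- The mean vector of `X`, coordinate by coordinate. -/
def mean (P : Measure Ω) (X : Ω → (Fin d → ℝ)) : Fin d → ℝ :=
  fun i => ∫ ω, X ω i ∂P

/-- `E[(X - E X)^+]`, coordinate by coordinate. -/
def posDev (P : Measure Ω) (X : Ω → (Fin d → ℝ)) : Fin d → ℝ :=
  fun i => ∫ ω, max 0 (X ω i - mean P X i) ∂P

/-- `E[(X - E X)^-]`, coordinate by coordinate. -/
def negDev (P : Measure Ω) (X : Ω → (Fin d → ℝ)) : Fin d → ℝ :=
  fun i => ∫ ω, max 0 (-(X ω i - mean P X i)) ∂P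

/-- The set of all `(t, s)` in the closure of `R` with `t α + ζ ≤ s ≤ t β + η` in every
coordinate. -/
def feasibleSet (R : Set (ℝ × (Fin d → ℝ))) (α β ζ η : Fin d → ℝ) :
    Set (ℝ × (Fin d → ℝ)) :=
  {p | p ∈ closure R ∧ p.1 • α + ζ ≤ p.2 ∧ p.2 ≤ p.1 • β + η}

end GeomStop

end

/-! The natural candidate for a feasible point is the pair (E[M], E[S_M]), available once E[M] is
finite. It lies in the closure of `R`, because (M, S_M) does almost surely and the mean of an
integrable vector with values in a closed convex set stays in that set. M is not a stopping time, so
Wald's identity does not apply to S_M directly. However N_0 ≤ M ≤ N and N is a stopping time. Split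
the centred increments into positive and negative parts: each partial sum of either part is monotone
in time, so S_M is compared with sums up to N_0 and N, and Wald at N gives the mean
(`integral_sum_range_bounds`). Inserting E[N] ≤ λ E[M] + K turns these bounds into the linear
constraints (`exists_feasible_of_lintegral_lastTime_ne_top`). If E[M] is infinite, the supremum must
be shown infinite. Were some point of the ray t ↦ (t, tμ) outside the closure, a separating
hyperplane would bound M by a constant multiple of a constant plus the maximum of a random walk with
negative drift and finite variance, whose mean is finite (`integral_maxWalk_le`,
`lintegral_lastTime_lt_top`). So the whole ray lies in the closure, and its far points are feasible
(`mem_feasibleSet_of_ray`). -/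

namespace GeomStop

/-! ### Maximum of a random walk with negative drift -/

/-- The maximum of the first `n + 1` partial sums of a real sequence (including the empty sum),
computed from the right. -/
def maxWalk : ℕ → (ℕ → ℝ) → ℝ
  | 0, _ => 0
  | n + 1, x => max 0 (x 0 + maxWalk n (fun i => x (i + 1)))

lemma maxWalk_nonneg (n : ℕ) (x : ℕ → ℝ) : 0 ≤ maxWalk n x := by
  cases n with
  | zero => exact le_rfl
  | succ n => exact le_max_left _ _

lemma maxWalk_le_succ (n : ℕ) (x : ℕ → ℝ) : maxWalk n x ≤ maxWalk (n + 1) x := by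
  induction n generalizing x with
  | zero => exact maxWalk_nonneg 1 x
  | succ n ih =>
    change max 0 _ ≤ max 0 _
    gcongr
    exact ih _

lemma sum_range_le_maxWalk (n : ℕ) (x : ℕ → ℝ) : ∑ i ∈ Finset.range n, x i ≤ maxWalk n x := by
  induction n generalizing x with
  | zero => simp [maxWalk]
  | succ n ih =>
    rw [Finset.sum_range_succ']
    exact le_max_of_le_right (by linarith [ih fun i => x (i + 1)])

lemma maxWalk_le_sum_abs (n : ℕ) (x : ℕ → ℝ) : maxWalk n x ≤ ∑ i ∈ Finset.range n, |x i| := by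
  induction n generalizing x with
  | zero => simp [maxWalk]
  | succ n ih =>
    rw [Finset.sum_range_succ']
    exact max_le (by positivity) (by linarith [ih fun i => x (i + 1), le_abs_self (x 0)])

lemma measurable_maxWalk (n : ℕ) : Measurable (maxWalk n) := by
  induction n with
  | zero => exact measurable_const
  | succ n ih =>
    have h : Measurable fun x : ℕ → ℝ => maxWalk n (fun i => x (i + 1)) :=
      ih.comp (measurable_pi_lambda _ fun i => measurable_pi_apply _)
    exact measurable_const.max ((measurable_pi_apply 0).add h)

variable {Ω : Type*} [MeasurableSpace Ω] {P : Measure Ω}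

lemma memLp_maxWalk {ξ : ℕ → Ω → ℝ} (hξ : ∀ i, Measurable (ξ i)) (h2 : ∀ i, MemLp (ξ i) 2 P)
    (n : ℕ) : MemLp (fun ω => maxWalk n (fun i => ξ i ω)) 2 P := by
  refine (memLp_finsetSum (f := fun i ω => |ξ i ω|) (Finset.range n) fun i _ => (h2 i).abs).of_le
    ((measurable_maxWalk n).comp (measurable_pi_lambda _ hξ)).aestronglyMeasurable
    (ae_of_all _ fun ω => ?_)
  rw [Real.norm_of_nonneg (maxWalk_nonneg _ _),
    Real.norm_of_nonneg (Finset.sum_nonneg fun i _ => abs_nonneg _)]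
  exact maxWalk_le_sum_abs n _

/-- Functions of disjoint blocks of an independent family generate independent σ-algebras. -/
lemma indep_iSup_comap {E : Type*} [MeasurableSpace E] {f : ℕ → Ω → E}
    (hf : ∀ i, Measurable (f i)) (hi : iIndepFun f P) {S T : Set ℕ} (hST : Disjoint S T) :
    Indep (⨆ i ∈ S, MeasurableSpace.comap (f i) inferInstance)
      (⨆ i ∈ T, MeasurableSpace.comap (f i) inferInstance) P :=
  indep_iSup_of_disjoint (fun i => (hf i).comap_le) hi.iIndep hST

omit [MeasurableSpace Ω] in
lemma measurable_iSup_comap {E : Type*} [MeasurableSpace E] (f : ℕ → Ω → E) {S : Set ℕ} {i : ℕ}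
    (hiS : i ∈ S) :
    Measurable[⨆ i ∈ S, MeasurableSpace.comap (f i) inferInstance] (f i) :=
  (comap_measurable (f i)).mono (le_iSup₂_of_le i hiS le_rfl) le_rfl

/-- The expected maximum of a random walk with negative drift and finite variance is bounded
uniformly in the horizon. -/
theorem integral_maxWalk_le [IsProbabilityMeasure P] {ξ : ℕ → Ω → ℝ}
    (hξ : ∀ i, Measurable (ξ i)) (hind : iIndepFun ξ P) (hid : ∀ i, IdentDistrib (ξ i) (ξ 0) P P)
    (h2 : MemLp (ξ 0) 2 P) {δ : ℝ} (hδ : ∫ ω, ξ 0 ω ∂P = -δ) (n : ℕ) :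
    2 * δ * ∫ ω, maxWalk n (fun i => ξ i ω) ∂P ≤ ∫ ω, ξ 0 ω ^ 2 ∂P := by
  have h2' (i : ℕ) : MemLp (ξ i) 2 P := (hid i).memLp_iff.mpr h2
  -- The shifted walk has the law of the original one and is independent of `ξ 0`, so the recursion
  -- for `maxWalk` relates moments of one and the same variable.
  have hshift : IdentDistrib (fun ω i => ξ (i + 1) ω) (fun ω i => ξ i ω) P P :=
    IdentDistrib.pi (fun i => (hid (i + 1)).trans (hid i).symm)
      (hind.precomp (add_left_injective 1)) hind
  have hw := memLp_maxWalk hξ h2' n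
  have hv := memLp_maxWalk (fun i => hξ (i + 1)) (fun i => h2' (i + 1)) n
  have hvw := hshift.comp (measurable_maxWalk n)
  have hindv : IndepFun (ξ 0) (fun ω => maxWalk n (fun i => ξ (i + 1) ω)) P := by
    have h := indep_iSup_comap hξ hind (S := {0}) (T := Set.Ici 1) (by simp)
    rw [IndepFun_iff_Indep]
    refine indep_of_indep_of_le_left (indep_of_indep_of_le_right h ?_) ?_
    · refine Measurable.comap_le ((measurable_maxWalk n).comp ?_)
      exact @measurable_pi_lambda _ _ _ (_) _ _ fun i => measurable_iSup_comap ξ (by simp)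
    · exact (measurable_iSup_comap ξ (by simp)).comap_le
  have e1 : ∫ ω, maxWalk n (fun i => ξ (i + 1) ω) ∂P = ∫ ω, maxWalk n (fun i => ξ i ω) ∂P :=
    hvw.integral_eq
  have e2 : ∫ ω, maxWalk n (fun i => ξ (i + 1) ω) ^ 2 ∂P
      = ∫ ω, maxWalk n (fun i => ξ i ω) ^ 2 ∂P := hvw.sq.integral_eq
  have e3 : ∫ ω, ξ 0 ω * maxWalk n (fun i => ξ (i + 1) ω) ∂P
      = -δ * ∫ ω, maxWalk n (fun i => ξ i ω) ∂P := by
    rw [hindv.integral_fun_mul_eq_mul_integral h2.1 hv.1, e1, hδ]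
  have i3 : Integrable (fun ω => ξ 0 ω * maxWalk n (fun i => ξ (i + 1) ω)) P :=
    h2.integrable_mul hv
  -- With W_n the maximum and W_n' its shifted copy, W_n² ≤ W_{n+1}² ≤ (ξ_0 + W_n')². In expectation
  -- the second moments of W_n and W_n' cancel, which leaves the bound on 2δ E[W_n].
  have l1 : ∫ ω, maxWalk n (fun i => ξ i ω) ^ 2 ∂P
      ≤ ∫ ω, (ξ 0 ω ^ 2 + 2 * (ξ 0 ω * maxWalk n (fun i => ξ (i + 1) ω))
        + maxWalk n (fun i => ξ (i + 1) ω) ^ 2) ∂P := by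
    refine integral_mono hw.integrable_sq
      ((h2.integrable_sq.add (i3.const_mul 2)).add hv.integrable_sq) fun ω => ?_
    have a := maxWalk_nonneg n (fun i => ξ i ω)
    have b := maxWalk_le_succ n (fun i => ξ i ω)
    have c : maxWalk (n + 1) (fun i => ξ i ω) ^ 2
        ≤ (ξ 0 ω + maxWalk n (fun i => ξ (i + 1) ω)) ^ 2 := by
      change max 0 _ ^ 2 ≤ _
      rcases max_cases 0 (ξ 0 ω + maxWalk n (fun i => ξ (i + 1) ω)) with h | h
      · rw [h.1, zero_pow two_ne_zero]; exact sq_nonneg _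
      · rw [h.1]
    have d := pow_le_pow_left₀ a b 2
    dsimp only
    linarith [add_sq (ξ 0 ω) (maxWalk n (fun i => ξ (i + 1) ω))]
  rw [integral_add (f := fun ω => ξ 0 ω ^ 2 + 2 * (ξ 0 ω * maxWalk n (fun i => ξ (i + 1) ω)))
      (h2.integrable_sq.add (i3.const_mul 2)) hv.integrable_sq,
    integral_add h2.integrable_sq (i3.const_mul 2), integral_const_mul, e2, e3] at l1
  linarith

end GeomStop

/-! ### Extended-integer random times and Wald's identity -/

namespace GeomStop

variable {Ω : Type*} [MeasurableSpace Ω] {P : Measure Ω}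

lemma measurable_eval_nat {E : Type*} [MeasurableSpace E] {f : ℕ → Ω → E}
    (hf : ∀ i, Measurable (f i)) {m : Ω → ℕ} (hm : Measurable m) :
    Measurable fun ω => f (m ω) ω :=
  (measurable_from_prod_countable_right (f := fun p : ℕ × Ω => f p.1 p.2) hf).comp
    (hm.prodMk measurable_id)

lemma measurable_enat {T : Ω → ℕ∞} (hT : ∀ i : ℕ, MeasurableSet {ω | (i : ℕ∞) < T ω}) :
    Measurable T := by
  refine measurable_to_countable' fun x => ?_
  induction x with
  | top =>
    convert MeasurableSet.iInter hT using 1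
    ext ω
    simp only [Set.mem_preimage, Set.mem_singleton_iff, Set.mem_iInter, Set.mem_ofPred_eq]
    exact ENat.eq_top_iff_forall_gt
  | coe n =>
    have : T ⁻¹' {(n : ℕ∞)} = {ω | (n : ℕ∞) < T ω}ᶜ ∩ ⋂ i : ℕ, ⋂ _ : i < n,
        {ω | (i : ℕ∞) < T ω} := by
      ext ω
      simp only [Set.mem_preimage, Set.mem_singleton_iff, Set.mem_inter_iff, Set.mem_compl_iff,
        Set.mem_iInter, Set.mem_ofPred_eq, not_lt]
      constructor
      · intro h
        simp [h]
      · rintro ⟨h1, h2⟩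
        lift T ω to ℕ using ne_top_of_le_ne_top (ENat.natCast_ne_top n) h1 with k
        norm_cast at *
        by_contra hne
        exact lt_irrefl _ (h2 k (by omega))
    rw [this]
    exact (hT n).compl.inter (.iInter fun i => .iInter fun _ => hT i)

omit [MeasurableSpace Ω] in
lemma tsum_indicator_lt {M : Type*} [AddCommMonoid M] [TopologicalSpace M] [T2Space M]
    {T : Ω → ℕ∞} (f : ℕ → Ω → M) {ω : Ω} (h : T ω ≠ ⊤) :
    ∑' i : ℕ, {ω | (i : ℕ∞) < T ω}.indicator (f i) ω
      = ∑ i ∈ Finset.range (T ω).toNat, f i ω := by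
  have hlt (i : ℕ) : (i : ℕ∞) < T ω ↔ i < (T ω).toNat := by
    conv_lhs => rw [← ENat.natCast_toNat h]
    exact Nat.cast_lt
  rw [tsum_eq_sum (s := Finset.range (T ω).toNat)]
  · refine Finset.sum_congr rfl fun i hi => ?_
    rw [Set.indicator_of_mem]
    exact (hlt i).mpr (Finset.mem_range.mp hi)
  · intro i hi
    rw [Set.indicator_of_notMem]
    exact fun h' => hi (Finset.mem_range.mpr ((hlt i).mp h'))

lemma ae_ne_top {T : Ω → ℕ∞} (hT : ∀ i : ℕ, MeasurableSet {ω | (i : ℕ∞) < T ω})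
    (hfin : ∫⁻ ω, (T ω : ℝ≥0∞) ∂P ≠ ⊤) : ∀ᵐ ω ∂P, T ω ≠ ⊤ := by
  have hm : Measurable fun ω => (T ω : ℝ≥0∞) := Measurable.of_discrete.comp (measurable_enat hT)
  filter_upwards [ae_lt_top hm hfin] with ω h h'
  simp [h'] at h

lemma toReal_lintegral_enat {T : Ω → ℕ∞} (hT : ∀ i : ℕ, MeasurableSet {ω | (i : ℕ∞) < T ω})
    (hfin : ∫⁻ ω, (T ω : ℝ≥0∞) ∂P ≠ ⊤) :
    Integrable (fun ω => ((T ω).toNat : ℝ)) P ∧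
      ∫ ω, ((T ω).toNat : ℝ) ∂P = (∫⁻ ω, (T ω : ℝ≥0∞) ∂P).toReal := by
  have hm : Measurable fun ω => (T ω : ℝ≥0∞) := Measurable.of_discrete.comp (measurable_enat hT)
  have he : (fun ω => (T ω : ℝ≥0∞).toReal) = fun ω => ((T ω).toNat : ℝ) := by
    funext ω
    induction T ω with
    | top => simp
    | coe n => simp
  rw [← he]
  exact ⟨integrable_toReal_of_lintegral_ne_top hm.aemeasurable hfin,
    integral_toReal hm.aemeasurable (ae_lt_top hm hfin)⟩

lemma lintegral_enat_eq_tsum {T : Ω → ℕ∞} (hT : ∀ i : ℕ, MeasurableSet {ω | (i : ℕ∞) < T ω})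
    (hfin : ∫⁻ ω, (T ω : ℝ≥0∞) ∂P ≠ ⊤) :
    ∫⁻ ω, (T ω : ℝ≥0∞) ∂P = ∑' i : ℕ, P {ω | (i : ℕ∞) < T ω} := by
  calc ∫⁻ ω, (T ω : ℝ≥0∞) ∂P
      = ∫⁻ ω, ∑' i : ℕ, {ω | (i : ℕ∞) < T ω}.indicator (fun _ => (1 : ℝ≥0∞)) ω ∂P := by
        refine lintegral_congr_ae ?_
        filter_upwards [ae_ne_top hT hfin] with ω h
        rw [tsum_indicator_lt _ h]
        lift T ω to ℕ using h with k
        simp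
    _ = _ := by
        rw [lintegral_tsum fun i => (measurable_const.indicator (hT i)).aemeasurable]
        exact tsum_congr fun i => by rw [lintegral_indicator (hT i)]; simp

/-- Wald's identity for a functional `g` of an i.i.d. sequence, stopped at a stopping time of
finite mean. -/
theorem wald [IsProbabilityMeasure P] {E : Type*} [MeasurableSpace E] {X : Ω → E}
    {Xs : ℕ → Ω → E} (hXs : ∀ i, Measurable (Xs i)) (hind : iIndepFun Xs P)
    (hid : ∀ i, IdentDistrib (Xs i) X P P) {g : E → ℝ} (hg : Measurable g)
    (hint : Integrable (fun ω => g (X ω)) P) {T : Ω → ℕ∞}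
    (hT : ∀ i : ℕ, MeasurableSet[⨆ j ∈ Set.Iio i, MeasurableSpace.comap (Xs j) inferInstance]
      {ω | (i : ℕ∞) < T ω})
    (hfin : ∫⁻ ω, (T ω : ℝ≥0∞) ∂P ≠ ⊤) :
    Integrable (fun ω => ∑ i ∈ Finset.range (T ω).toNat, g (Xs i ω)) P ∧
      ∫ ω, ∑ i ∈ Finset.range (T ω).toNat, g (Xs i ω) ∂P
        = (∫⁻ ω, (T ω : ℝ≥0∞) ∂P).toReal * ∫ ω, g (X ω) ∂P := by
  have hTm (i : ℕ) : MeasurableSet {ω | (i : ℕ∞) < T ω} :=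
    (iSup₂_le fun j _ => (hXs j).comap_le :
      (⨆ j ∈ Set.Iio i, MeasurableSpace.comap (Xs j) inferInstance) ≤ _) _ (hT i)
  have hgX (i : ℕ) : Measurable fun ω => g (Xs i ω) := hg.comp (hXs i)
  have hgid (i : ℕ) : IdentDistrib (fun ω => g (Xs i ω)) (fun ω => g (X ω)) P P := (hid i).comp hg
  -- The event i < T depends only on the samples with index below `i`, while `Xs i` is the next,
  -- fresh one.
  have hindep (i : ℕ) : Indep (⨆ j ∈ Set.Iio i, MeasurableSpace.comap (Xs j) inferInstance)
      (MeasurableSpace.comap (Xs i) inferInstance) P := by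
    refine indep_of_indep_of_le_right
      (indep_iSup_comap hXs hind (S := Set.Iio i) (T := {i}) (by simp)) ?_
    exact (measurable_iSup_comap Xs (by simp)).comap_le
  have hi1 {F : Type} [MeasurableSpace F] [Zero F] [One F] {h : E → F} (hh : Measurable h) (i : ℕ) :
      IndepFun ({ω | (i : ℕ∞) < T ω}.indicator (fun _ => (1 : F))) (fun ω => h (Xs i ω)) P := by
    rw [IndepFun_iff_Indep]
    refine indep_of_indep_of_le_left (indep_of_indep_of_le_right (hindep i) ?_) ?_
    · exact (hh.comp (comap_measurable (Xs i))).comap_le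
    · exact (@Measurable.indicator _ _ _ _ _ _ _ (@measurable_const _ _ _ _ _) (hT i)).comap_le
  set F : ℕ → Ω → ℝ := fun i => {ω | (i : ℕ∞) < T ω}.indicator (fun ω => g (Xs i ω)) with hF
  have hFm (i : ℕ) : Measurable (F i) := (hgX i).indicator (hTm i)
  have hFint (i : ℕ) : ∫ ω, F i ω ∂P = P.real {ω | (i : ℕ∞) < T ω} * ∫ ω, g (X ω) ∂P := by
    have := (hi1 (F := ℝ) hg i).integral_fun_mul_eq_mul_integral
      (measurable_const.indicator (hTm i)).aestronglyMeasurable (hgX i).aestronglyMeasurable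
    rw [integral_indicator_const _ (hTm i), smul_eq_mul, mul_one, (hgid i).integral_eq] at this
    rw [← this]
    congr 1 with ω
    by_cases h : (i : ℕ∞) < T ω <;> simp [hF, Set.indicator, h]
  have hFlint (i : ℕ) : ∫⁻ ω, ‖F i ω‖ₑ ∂P
      = P {ω | (i : ℕ∞) < T ω} * ∫⁻ ω, ‖g (X ω)‖ₑ ∂P := by
    have := lintegral_mul_eq_lintegral_mul_lintegral_of_indepFun''
      (measurable_const.indicator (hTm i)).aemeasurable (hgX i).enorm.aemeasurable
      (hi1 (F := ℝ≥0∞) hg.enorm i)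
    have hXi : ∫⁻ ω, ‖g (Xs i ω)‖ₑ ∂P = ∫⁻ ω, ‖g (X ω)‖ₑ ∂P :=
      ((hid i).comp hg.enorm).lintegral_eq
    rw [lintegral_indicator_const (hTm i), one_mul, hXi] at this
    rw [← this]
    congr 1 with ω
    by_cases h : (i : ℕ∞) < T ω <;> simp [hF, Set.indicator, h]
  -- The sum of absolute moments is E[T] E|g(X)|; its finiteness justifies exchanging sum and
  -- integral.
  have hsum : ∑' i, ∫⁻ ω, ‖F i ω‖ₑ ∂P ≠ ⊤ := by
    simp_rw [hFlint]
    rw [ENNReal.tsum_mul_right, ← lintegral_enat_eq_tsum hTm hfin]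
    exact ENNReal.mul_ne_top hfin hint.2.ne
  have hae : ∀ᵐ ω ∂P, ∑' i, F i ω = ∑ i ∈ Finset.range (T ω).toNat, g (Xs i ω) := by
    filter_upwards [ae_ne_top hTm hfin] with ω h
    exact tsum_indicator_lt (fun i ω => g (Xs i ω)) h
  refine ⟨⟨?_, ?_⟩, ?_⟩
  · exact (measurable_eval_nat (f := fun n ω => ∑ i ∈ Finset.range n, g (Xs i ω))
      (fun n => Finset.measurable_sum _ fun i _ => hgX i)
      (Measurable.of_discrete.comp (measurable_enat hTm))).aestronglyMeasurable
  · refine lt_of_le_of_lt ?_ hsum.lt_top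
    rw [← lintegral_tsum fun i => (hFm i).enorm.aemeasurable]
    refine lintegral_mono_ae ?_
    filter_upwards [ae_ne_top hTm hfin] with ω h
    have := tsum_indicator_lt (fun i ω => ‖g (Xs i ω)‖ₑ) h
    calc _ ≤ ∑ i ∈ Finset.range (T ω).toNat, ‖g (Xs i ω)‖ₑ := enorm_sum_le _ _
      _ = _ := by
        rw [← this]
        refine tsum_congr fun i => ?_
        by_cases h : (i : ℕ∞) < T ω <;> simp [hF, Set.indicator, h]
  · rw [← integral_congr_ae hae, integral_tsum (fun i => (hFm i).aestronglyMeasurable) hsum]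
    simp_rw [hFint]
    rw [tsum_mul_right, lintegral_enat_eq_tsum hTm hfin, ENNReal.tsum_toReal_eq]
    · rfl
    · exact fun i => measure_ne_top _ _

end GeomStop

/-! ### Pathwise structure of the stopping time and the last time -/

namespace GeomStop

variable {Ω : Type*} {d : ℕ} {R : Set (ℝ × (Fin d → ℝ))} {N : ℕ → ℕ} {Xs : ℕ → Ω → (Fin d → ℝ)}

lemma coe_lt_stopTime_iff (i : ℕ) (ω : Ω) :
    (i : ℕ∞) < stopTime R N Xs ω ↔
      ∀ l, 1 ≤ l → N l ≤ i → ((N l : ℝ), partialSum Xs (N l) ω) ∈ R := by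
  rw [← not_le]
  have : stopTime R N Xs ω ≤ i ↔
      ∃ l, 1 ≤ l ∧ N l ≤ i ∧ ((N l : ℝ), partialSum Xs (N l) ω) ∉ R := by
    -- Writing ≤ i as < i + 1 lets the infimum produce a witness without a separate proof that it is
    -- attained.
    rw [← ENat.lt_add_one_iff (ENat.natCast_ne_top i), stopTime, sInf_lt_iff]
    simp only [Set.mem_ofPred_eq, ENat.lt_add_one_iff
      (ENat.natCast_ne_top i)]
    constructor
    · rintro ⟨_, ⟨l, h1, rfl, h3⟩, h2⟩
      exact ⟨l, h1, by exact_mod_cast h2, h3⟩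
    · rintro ⟨l, h1, h2, h3⟩
      exact ⟨_, ⟨l, h1, rfl, h3⟩, by exact_mod_cast h2⟩
  rw [this]
  push Not
  rfl

lemma coe_lt_lastTime_iff (i : ℕ) (ω : Ω) :
    (i : ℕ∞) < lastTime R N Xs ω ↔ ∃ l, i < N l ∧ (N l : ℕ∞) < stopTime R N Xs ω := by
  rw [lastTime, lt_sSup_iff]
  constructor
  · rintro ⟨_, ⟨l, rfl, h⟩, hi⟩
    exact ⟨l, by exact_mod_cast hi, h⟩
  · rintro ⟨l, hi, h⟩
    exact ⟨_, ⟨l, rfl, h⟩, by exact_mod_cast hi⟩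

/-- Either sampling never stops, or it stops at one of the grid points and the last time is the
preceding grid point. -/
lemma stopTime_lastTime_cases (hN : StrictMono N) (ω : Ω) :
    (stopTime R N Xs ω = ⊤ ∧ lastTime R N Xs ω = ⊤ ∧
        ∀ l, 1 ≤ l → ((N l : ℝ), partialSum Xs (N l) ω) ∈ R) ∨
      ∃ l, stopTime R N Xs ω = N (l + 1) ∧ lastTime R N Xs ω = N l ∧
        (1 ≤ l → ((N l : ℝ), partialSum Xs (N l) ω) ∈ R) := by
  classical
  by_cases h : ∃ l, 1 ≤ l ∧ ((N l : ℝ), partialSum Xs (N l) ω) ∉ R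
  · right
    obtain ⟨h1, hR⟩ := Nat.find_spec h
    have hmin (l : ℕ) (hl : l < Nat.find h) (hl1 : 1 ≤ l) :
        ((N l : ℝ), partialSum Xs (N l) ω) ∈ R := by
      by_contra hc
      exact Nat.find_min h hl ⟨hl1, hc⟩
    obtain ⟨l, hl⟩ : ∃ l, Nat.find h = l + 1 := ⟨Nat.find h - 1, by omega⟩
    rw [hl] at h1 hR hmin
    have hs : stopTime R N Xs ω = N (l + 1) := by
      refine le_antisymm (sInf_le ⟨l + 1, h1, rfl, hR⟩) (le_sInf ?_)
      rintro _ ⟨k, hk, rfl, hkR⟩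
      norm_cast
      refine hN.monotone ?_
      by_contra hlt
      exact hkR (hmin k (by omega) hk)
    refine ⟨l, hs, ?_, hmin l (by omega)⟩
    refine le_antisymm (sSup_le ?_) (le_sSup ⟨l, rfl, ?_⟩)
    · rintro _ ⟨k, rfl, hk⟩
      rw [hs] at hk
      norm_cast at *
      have := hN.lt_iff_lt.mp hk
      exact hN.monotone (by omega)
    · rw [hs]
      exact_mod_cast hN (Nat.lt_succ_self l)
  · left
    push Not at h
    have hs : stopTime R N Xs ω = ⊤ :=
      ENat.eq_top_iff_forall_gt.mpr fun i => (coe_lt_stopTime_iff i ω).mpr fun l hl _ => h l hl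
    refine ⟨hs, ENat.eq_top_iff_forall_gt.mpr fun i => (coe_lt_lastTime_iff i ω).mpr ?_, h⟩
    exact ⟨i + 1, hN.le_apply, by simp [hs]⟩

variable [MeasurableSpace Ω]

lemma measurable_partialSum_of {n : ℕ} (hXs : ∀ i < n, Measurable (Xs i)) :
    Measurable (partialSum Xs n) :=
  Finset.measurable_sum _ fun i hi => hXs i (Finset.mem_range.mp hi)

omit [MeasurableSpace Ω] in
/-- Whether sampling continues after time `i` is decided by the first `i` observations. -/
lemma measurableSet_lt_stopTime (hR : MeasurableSet R) (i : ℕ) :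
    MeasurableSet[⨆ j ∈ Set.Iio i, MeasurableSpace.comap (Xs j) inferInstance]
      {ω | (i : ℕ∞) < stopTime R N Xs ω} := by
  have : {ω | (i : ℕ∞) < stopTime R N Xs ω} = ⋂ l, ⋂ _ : 1 ≤ l, ⋂ _ : N l ≤ i,
      (fun ω => ((N l : ℝ), partialSum Xs (N l) ω)) ⁻¹' R := by
    ext ω
    simp only [Set.mem_ofPred_eq, coe_lt_stopTime_iff, Set.mem_iInter, Set.mem_preimage]
  rw [this]
  refine MeasurableSet.iInter fun l => .iInter fun _ => .iInter fun hl => ?_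
  have hS : Measurable[⨆ j ∈ Set.Iio i, MeasurableSpace.comap (Xs j) inferInstance]
      (partialSum Xs (N l)) :=
    @measurable_partialSum_of _ _ _ (_) _ fun j hj => measurable_iSup_comap Xs (lt_of_lt_of_le hj hl)
  exact (measurable_const.prodMk hS) hR

end GeomStop

/-! ### Finite mean of the last time when the ray leaves the closure -/

namespace GeomStop

variable {Ω : Type*} {d : ℕ} {R : Set (ℝ × (Fin d → ℝ))} {N : ℕ → ℕ} {Xs : ℕ → Ω → (Fin d → ℝ)}
  [MeasurableSpace Ω] {P : Measure Ω} {X : Ω → (Fin d → ℝ)}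

lemma mean_eq_integral (hX : ∀ i, Integrable (fun ω => X ω i) P) : mean P X = ∫ ω, X ω ∂P := by
  funext i
  exact (eval_integral hX i).symm

lemma memLp_two_of_integrable_abs_pow_three [IsFiniteMeasure P] {f : Ω → ℝ} (hf : Measurable f)
    (h : Integrable (fun ω => |f ω| ^ 3) P) : MemLp f 2 P := by
  rw [memLp_two_iff_integrable_sq hf.aestronglyMeasurable]
  refine ((integrable_const (1 : ℝ)).add h).mono' (hf.pow_const 2).aestronglyMeasurable
    (ae_of_all _ fun ω => ?_)
  rw [Real.norm_of_nonneg (sq_nonneg _), ← sq_abs]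
  have h0 := abs_nonneg (f ω)
  simp only [Pi.add_apply]
  rcases le_total |f ω| 1 with h1 | h1
  · nlinarith [pow_nonneg h0 3]
  · nlinarith [pow_le_pow_right₀ h1 (show 2 ≤ 3 by norm_num)]

/-- If the ray through the mean leaves the closure of the continuity region, then the last time
before stopping is integrable. -/
theorem lintegral_lastTime_lt_top [IsProbabilityMeasure P]
    (hXs : ∀ i, Measurable (Xs i)) (hindep : iIndepFun Xs P)
    (hident : ∀ i, IdentDistrib (Xs i) X P P) (hN : StrictMono N)
    (hconv : Convex ℝ (closure R)) (hzero : (0, 0) ∈ closure R)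
    (hstart : ∀ᵐ ω ∂P, ((N 0 : ℝ), partialSum Xs (N 0) ω) ∈ closure R)
    (hX2 : ∀ i, MemLp (fun ω => X ω i) 2 P) {t : ℝ} (ht : 0 < t)
    (hout : (t, t • mean P X) ∉ closure R) :
    ∫⁻ ω, (lastTime R N Xs ω : ℝ≥0∞) ∂P < ⊤ := by
  obtain ⟨f, c, hc, hf⟩ := geometric_hahn_banach_closed_point hconv isClosed_closure hout
  have hc0 : 0 < c := by simpa [Prod.mk_zero_zero] using hc _ hzero
  set μ := mean P X with hμ
  set κ := f (1, μ) with hκ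
  -- The origin lies in the closure, so 0 < c; the separated point has f-value t κ > c. Hence the
  -- functional grows along the mean direction.
  have hκ0 : 0 < κ := by
    have : f (t, t • μ) = t * κ := by
      rw [hκ, ← smul_eq_mul, ← map_smul]; simp
    rw [this] at hf
    exact pos_of_mul_pos_right (hc0.trans hf) ht.le
  set g : (Fin d → ℝ) →L[ℝ] ℝ := f.comp (ContinuousLinearMap.inr ℝ ℝ _) with hg
  have hfg (n : ℝ) (s : Fin d → ℝ) : f (n, s) = n * κ + g (s - n • μ) := by
    rw [hκ, hg, ← smul_eq_mul, ← map_smul]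
    simp [← map_add]
  -- The growth rate κ is split in two: one half is the negative drift of the walk, the other half
  -- remains to bound the time in `hbound`.
  set h : (Fin d → ℝ) → ℝ := fun x => -g (x - μ) - κ / 2 with hh
  have hhm : Measurable h := by fun_prop
  have hXL : MemLp X 2 P := MemLp.of_eval hX2
  have hXi : Integrable X P := hXL.integrable one_le_two
  have hgL : MemLp (fun ω => g (X ω - μ)) 2 P := g.comp_memLp' (hXL.sub (memLp_const μ))
  have hhL : MemLp (fun ω => h (X ω)) 2 P := hgL.neg.sub (memLp_const (κ / 2))
  have hhint : ∫ ω, h (X ω) ∂P = -(κ / 2) := by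
    have h1 : ∫ ω, g (X ω - μ) ∂P = 0 := by
      rw [g.integral_comp_comm (φ := fun ω => X ω - μ) (hXi.sub (integrable_const μ)),
        integral_sub hXi (integrable_const μ), hμ, mean_eq_integral hXi.eval]
      simp
    have h2 : Integrable (fun ω => g (X ω - μ)) P := hgL.integrable one_le_two
    simp only [hh]
    rw [integral_sub (f := fun ω => -g (X ω - μ)) h2.neg (integrable_const _), integral_neg, h1]
    simp
  set ξ : ℕ → Ω → ℝ := fun i ω => h (Xs i ω) with hξ
  have hξm (i : ℕ) : Measurable (ξ i) := hhm.comp (hXs i)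
  have hξX (i : ℕ) : IdentDistrib (ξ i) (fun ω => h (X ω)) P P := (hident i).comp hhm
  have hξL (i : ℕ) : MemLp (ξ i) 2 P := (hξX i).memLp_iff.mpr hhL
  have hwalk (n : ℕ) := integral_maxWalk_le hξm (hindep.comp (fun _ => h) fun _ => hhm)
    (fun i => (hξX i).trans (hξX 0).symm) (hξL 0) (δ := κ / 2)
    (by rw [(hξX 0).integral_eq, hhint]) n
  set V := ∫ ω, ξ 0 ω ^ 2 ∂P
  have hbound (l : ℕ) (ω : Ω) (hl : ((N l : ℝ), partialSum Xs (N l) ω) ∈ closure R) :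
      (N l : ℝ) ≤ 2 / κ * (c + maxWalk (N l) fun i => ξ i ω) := by
    have h1 := hc _ hl
    have h2 := sum_range_le_maxWalk (N l) fun i => ξ i ω
    have h3 : ∑ i ∈ Finset.range (N l), ξ i ω
        = -g (partialSum Xs (N l) ω - (N l : ℝ) • μ) - N l * (κ / 2) := by
      simp [hξ, hh, partialSum, Finset.sum_sub_distrib, map_sub, map_sum]
    rw [hfg] at h1
    rw [div_mul_eq_mul_div, le_div_iff₀ hκ0]
    linarith
  -- The horizon `N l` in `hbound` is random once l is, so the bound is replaced by its supremum
  -- over all horizons, and monotone convergence applies.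
  set B : ℕ → Ω → ℝ≥0∞ := fun n ω => ENNReal.ofReal (2 / κ * (c + maxWalk n fun i => ξ i ω))
  have hBm (n : ℕ) : Measurable (B n) :=
    ((((measurable_maxWalk n).comp (measurable_pi_lambda _ hξm)).const_add c).const_mul
      (2 / κ)).ennreal_ofReal
  have hBmono : Monotone B := by
    refine monotone_nat_of_le_succ fun n ω => ENNReal.ofReal_le_ofReal ?_
    gcongr
    exact maxWalk_le_succ n _
  have hlast : ∀ᵐ ω ∂P, (lastTime R N Xs ω : ℝ≥0∞) ≤ ⨆ n, B n ω := by
    filter_upwards [hstart] with ω h0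
    have hB (l : ℕ) (hl : ((N l : ℝ), partialSum Xs (N l) ω) ∈ closure R) :
        (N l : ℝ≥0∞) ≤ ⨆ n, B n ω := by
      refine le_iSup_of_le (N l) ?_
      rw [← ENNReal.ofReal_natCast]
      exact ENNReal.ofReal_le_ofReal (hbound l ω hl)
    rcases stopTime_lastTime_cases (R := R) (Xs := Xs) hN ω with ⟨-, h1, h2⟩ | ⟨l, -, h1, h2⟩
    -- On a path that never stops, the bounds hold at arbitrarily late grid points, so the supremum
    -- is infinite and the domination persists. Almost sure stopping need not be known beforehand.
    · have : ⨆ n, B n ω = ⊤ := by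
        refine ENNReal.eq_top_of_forall_nnreal_le fun r => ?_
        obtain ⟨n, hn⟩ := exists_nat_ge r
        refine le_trans ?_ (hB (n + 1) (subset_closure (h2 _ (by omega))))
        have : n ≤ N (n + 1) := n.le_succ.trans hN.le_apply
        exact_mod_cast hn.trans (by exact_mod_cast this)
      rw [this]
      exact le_top
    · rw [h1, ENat.toENNReal_coe]
      refine hB l ?_
      rcases l.eq_zero_or_pos with rfl | hl
      · exact h0
      · exact subset_closure (h2 hl)
  refine lt_of_le_of_lt (lintegral_mono_ae hlast) ?_
  rw [lintegral_iSup hBm hBmono]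
  refine lt_of_le_of_lt (iSup_le fun n => ?_)
    (ENNReal.ofReal_lt_top (r := 2 / κ * (c + V / κ)))
  have hZ : Integrable (fun ω => maxWalk n fun i => ξ i ω) P :=
    (memLp_maxWalk hξm hξL n).integrable one_le_two
  rw [← ofReal_integral_eq_lintegral_ofReal
    (f := fun ω => 2 / κ * (c + maxWalk n fun i => ξ i ω)) (((integrable_const c).add hZ).const_mul (2 / κ))
    (ae_of_all _ fun ω => mul_nonneg (by positivity)
      (add_nonneg hc0.le (maxWalk_nonneg n _)))]
  refine ENNReal.ofReal_le_ofReal ?_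
  rw [integral_const_mul, integral_add (integrable_const c) hZ]
  simp only [integral_const, probReal_univ, one_smul]
  gcongr
  rw [le_div_iff₀ hκ0]
  linarith [hwalk n]

end GeomStop

/-! ### Mean of the sum at the last time -/

namespace GeomStop

/-- The sum to `m` is its positive-part sum minus its negative-part sum. The former is at least the
one to `a`, the latter at most the one to `n`, and y⁻ = y⁺ - y. -/
lemma sum_range_sub_posPart_le (y : ℕ → ℝ) {a m n : ℕ} (ham : a ≤ m) (hmn : m ≤ n) :
    ∑ i ∈ Finset.range n, y i - ∑ i ∈ Finset.range n, max 0 (y i)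
      + ∑ i ∈ Finset.range a, max 0 (y i) ≤ ∑ i ∈ Finset.range m, y i := by
  have h1 : ∑ i ∈ Finset.range a, max 0 (y i) ≤ ∑ i ∈ Finset.range m, max 0 (y i) :=
    Finset.sum_le_sum_of_subset_of_nonneg (Finset.range_mono ham) fun i _ _ => le_max_left _ _
  have h2 : ∑ i ∈ Finset.range m, (max 0 (y i) - y i) ≤ ∑ i ∈ Finset.range n, (max 0 (y i) - y i) :=
    Finset.sum_le_sum_of_subset_of_nonneg (Finset.range_mono hmn) fun i _ _ =>
      sub_nonneg.mpr (le_max_right _ _)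
  rw [Finset.sum_sub_distrib, Finset.sum_sub_distrib] at h2
  linarith

variable {Ω : Type*} [MeasurableSpace Ω] {P : Measure Ω}

/-- For a centred functional `g` of an i.i.d. sequence, bounds for the mean of the sum up to an
integer time `m` that is not a stopping time, but lies between a constant `a` and a stopping
time `T`. -/
theorem integral_sum_range_bounds [IsProbabilityMeasure P] {E : Type*} [MeasurableSpace E]
    {X : Ω → E} {Xs : ℕ → Ω → E} (hXs : ∀ i, Measurable (Xs i)) (hind : iIndepFun Xs P)
    (hid : ∀ i, IdentDistrib (Xs i) X P P) {g : E → ℝ} (hg : Measurable g)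
    (hint : Integrable (fun ω => g (X ω)) P) (hg0 : ∫ ω, g (X ω) ∂P = 0) {T : Ω → ℕ∞}
    (hT : ∀ i : ℕ, MeasurableSet[⨆ j ∈ Set.Iio i, MeasurableSpace.comap (Xs j) inferInstance]
      {ω | (i : ℕ∞) < T ω})
    (hfin : ∫⁻ ω, (T ω : ℝ≥0∞) ∂P ≠ ⊤) {m : Ω → ℕ} (hm : Measurable m) {a : ℕ}
    (hmT : ∀ᵐ ω ∂P, a ≤ m ω ∧ m ω ≤ (T ω).toNat) :
    Integrable (fun ω => ∑ i ∈ Finset.range (m ω), g (Xs i ω)) P ∧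
      (a - (∫⁻ ω, (T ω : ℝ≥0∞) ∂P).toReal) * ∫ ω, max 0 (g (X ω)) ∂P
        ≤ ∫ ω, ∑ i ∈ Finset.range (m ω), g (Xs i ω) ∂P ∧
      ∫ ω, ∑ i ∈ Finset.range (m ω), g (Xs i ω) ∂P
        ≤ ((∫⁻ ω, (T ω : ℝ≥0∞) ∂P).toReal - a) * ∫ ω, max 0 (-g (X ω)) ∂P := by
  have key {g : E → ℝ} (hg : Measurable g) (hint : Integrable (fun ω => g (X ω)) P)
      (hg0 : ∫ ω, g (X ω) ∂P = 0) : ∃ L : Ω → ℝ, Integrable L P ∧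
        (L ≤ᵐ[P] fun ω => ∑ i ∈ Finset.range (m ω), g (Xs i ω)) ∧
        ∫ ω, L ω ∂P = (a - (∫⁻ ω, (T ω : ℝ≥0∞) ∂P).toReal) * ∫ ω, max 0 (g (X ω)) ∂P := by
    have hgm : Measurable fun x => max 0 (g x) := measurable_const.max hg
    have hmax : Integrable (fun ω => max 0 (g (X ω))) P := (integrable_const 0).sup hint
    have hmaxs (i : ℕ) : IdentDistrib (fun ω => max 0 (g (Xs i ω))) (fun ω => max 0 (g (X ω))) P P :=
      (hid i).comp hgm
    obtain ⟨i1, e1⟩ := wald hXs hind hid hg hint hT hfin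
    obtain ⟨i2, e2⟩ := wald hXs hind hid hgm hmax hT hfin
    have i3 : Integrable (fun ω => ∑ i ∈ Finset.range a, max 0 (g (Xs i ω))) P :=
      integrable_finsetSum _ fun i _ => (hmaxs i).integrable_iff.mpr hmax
    -- This minorant involves only the stopping time `T` and the constant `a`, so Wald computes its
    -- mean; the first sum has mean zero.
    refine ⟨fun ω => ∑ i ∈ Finset.range (T ω).toNat, g (Xs i ω)
      - ∑ i ∈ Finset.range (T ω).toNat, max 0 (g (Xs i ω))
      + ∑ i ∈ Finset.range a, max 0 (g (Xs i ω)), (i1.sub i2).add i3, ?_, ?_⟩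
    · filter_upwards [hmT] with ω h
      exact sum_range_sub_posPart_le (fun i => g (Xs i ω)) h.1 h.2
    · rw [integral_add (f := fun ω => ∑ i ∈ Finset.range (T ω).toNat, g (Xs i ω)
          - ∑ i ∈ Finset.range (T ω).toNat, max 0 (g (Xs i ω))) (i1.sub i2) i3,
        integral_sub i1 i2, e1, e2, hg0,
        integral_finsetSum _ fun i _ => (hmaxs i).integrable_iff.mpr hmax]
      simp_rw [(hmaxs _).integral_eq]
      simp
      ring
  obtain ⟨L, hL, hLle, eL⟩ := key hg hint hg0
  -- The upper bound is the lower bound for `-g`.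
  obtain ⟨U, hU, hUle, eU⟩ := key (g := fun x => -g x) hg.neg hint.neg (by
    rw [integral_neg, hg0, neg_zero])
  have hUle' : (fun ω => ∑ i ∈ Finset.range (m ω), g (Xs i ω)) ≤ᵐ[P] fun ω => -U ω := by
    filter_upwards [hUle] with ω h
    simp only [Finset.sum_neg_distrib] at h
    linarith
  have hmeas : AEStronglyMeasurable (fun ω => ∑ i ∈ Finset.range (m ω), g (Xs i ω)) P :=
    (measurable_eval_nat (f := fun n ω => ∑ i ∈ Finset.range n, g (Xs i ω))
      (fun n => Finset.measurable_sum _ fun i _ => hg.comp (hXs i)) hm).aestronglyMeasurable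
  have hI : Integrable (fun ω => ∑ i ∈ Finset.range (m ω), g (Xs i ω)) P := by
    refine (hL.abs.add hU.abs).mono' hmeas ?_
    filter_upwards [hLle, hUle'] with ω h1 h2
    rw [Real.norm_eq_abs, abs_le]
    simp only [Pi.add_apply] at *
    constructor <;> linarith [neg_abs_le (L ω), neg_abs_le (U ω), abs_nonneg (L ω), abs_nonneg (U ω)]
  refine ⟨hI, eL ▸ integral_mono_ae hL hI hLle, ?_⟩
  have := integral_mono_ae (g := fun ω => -U ω) hI hU.neg hUle'
  rw [integral_neg, eU] at this
  linarith

variable {d : ℕ} {R : Set (ℝ × (Fin d → ℝ))} {N : ℕ → ℕ} {Xs : ℕ → Ω → (Fin d → ℝ)}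
  {X : Ω → (Fin d → ℝ)}

lemma measurableSet_lt_stopTime' (hXs : ∀ i, Measurable (Xs i)) (hR : MeasurableSet R) (i : ℕ) :
    MeasurableSet {ω | (i : ℕ∞) < stopTime R N Xs ω} :=
  (iSup₂_le fun j _ => (hXs j).comap_le :
    (⨆ j ∈ Set.Iio i, MeasurableSpace.comap (Xs j) inferInstance) ≤ _) _
    (measurableSet_lt_stopTime hR i)

lemma measurableSet_lt_lastTime (hXs : ∀ i, Measurable (Xs i)) (hR : MeasurableSet R) (i : ℕ) :
    MeasurableSet {ω | (i : ℕ∞) < lastTime R N Xs ω} := by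
  have : {ω | (i : ℕ∞) < lastTime R N Xs ω}
      = ⋃ l, ⋃ _ : i < N l, {ω | (N l : ℕ∞) < stopTime R N Xs ω} := by
    ext ω
    simp [coe_lt_lastTime_iff]
  rw [this]
  exact .iUnion fun l => .iUnion fun _ => measurableSet_lt_stopTime' hXs hR _

/-- Almost surely M = N_l and N = N_{l+1} for some l, so the growth condition on the grid holds
pathwise between M and N and can be integrated. -/
lemma lintegral_stopTime_le [IsProbabilityMeasure P] (hXs : ∀ i, Measurable (Xs i))
    (hR : MeasurableSet R) (hN : StrictMono N) {lam K : ℝ}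
    (hI : ∀ l, (N (l + 1) : ℝ) ≤ lam * N l + K)
    (hfin : ∫⁻ ω, (lastTime R N Xs ω : ℝ≥0∞) ∂P ≠ ⊤) :
    ∫⁻ ω, (stopTime R N Xs ω : ℝ≥0∞) ∂P ≠ ⊤ ∧
      (∫⁻ ω, (stopTime R N Xs ω : ℝ≥0∞) ∂P).toReal
        ≤ lam * (∫⁻ ω, (lastTime R N Xs ω : ℝ≥0∞) ∂P).toReal + K := by
  have hM := measurableSet_lt_lastTime (N := N) hXs hR
  obtain ⟨i1, e1⟩ := toReal_lintegral_enat hM hfin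
  have hae : ∀ᵐ ω ∂P, 0 ≤ lam * (lastTime R N Xs ω).toNat + K ∧
      (stopTime R N Xs ω : ℝ≥0∞) ≤ ENNReal.ofReal (lam * (lastTime R N Xs ω).toNat + K) := by
    filter_upwards [ae_ne_top hM hfin] with ω h
    rcases stopTime_lastTime_cases (R := R) (Xs := Xs) hN ω with ⟨-, h1, -⟩ | ⟨l, h1, h2, -⟩
    · exact absurd h1 h
    · rw [h1, h2]
      simp only [ENat.toNat_natCast, ENat.toENNReal_coe]
      refine ⟨(Nat.cast_nonneg _).trans (hI l), ?_⟩
      rw [← ENNReal.ofReal_natCast]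
      exact ENNReal.ofReal_le_ofReal (hI l)
  have i2 : Integrable (fun ω => lam * ((lastTime R N Xs ω).toNat : ℝ) + K) P :=
    (i1.const_mul lam).add (integrable_const K)
  have hle : ∫⁻ ω, (stopTime R N Xs ω : ℝ≥0∞) ∂P
      ≤ ENNReal.ofReal (lam * (∫⁻ ω, (lastTime R N Xs ω : ℝ≥0∞) ∂P).toReal + K) := by
    refine (lintegral_mono_ae (hae.mono fun ω h => h.2)).trans_eq ?_
    rw [← ofReal_integral_eq_lintegral_ofReal i2 (hae.mono fun ω h => h.1),
      integral_add (i1.const_mul lam) (integrable_const K), integral_const_mul, e1]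
    simp
  have hnn : 0 ≤ lam * (∫⁻ ω, (lastTime R N Xs ω : ℝ≥0∞) ∂P).toReal + K := by
    have := integral_nonneg_of_ae (hae.mono fun ω h => h.1)
    rw [integral_add (i1.const_mul lam) (integrable_const K), integral_const_mul, e1] at this
    simpa using this
  exact ⟨ne_top_of_le_ne_top ENNReal.ofReal_ne_top hle, ENNReal.toReal_le_of_le_ofReal hnn hle⟩

/-- The pair formed by the expected last time and the expected sum at that time is feasible. -/
theorem exists_feasible_of_lintegral_lastTime_ne_top [IsProbabilityMeasure P]
    (hXs : ∀ i, Measurable (Xs i)) (hindep : iIndepFun Xs P)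
    (hident : ∀ i, IdentDistrib (Xs i) X P P) (hN : StrictMono N) (hR : MeasurableSet R)
    {lam K : ℝ} (hI : ∀ l, (N (l + 1) : ℝ) ≤ lam * N l + K)
    (hconv : Convex ℝ (closure R))
    (hstart : ∀ᵐ ω ∂P, ((N 0 : ℝ), partialSum Xs (N 0) ω) ∈ closure R)
    (hXint : ∀ i, Integrable (fun ω => X ω i) P)
    (hfin : ∫⁻ ω, (lastTime R N Xs ω : ℝ≥0∞) ∂P ≠ ⊤) :
    ∃ s, ((∫⁻ ω, (lastTime R N Xs ω : ℝ≥0∞) ∂P).toReal, s) ∈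
      feasibleSet R (mean P X - lam • posDev P X) (mean P X + lam • negDev P X)
        (((N 0 : ℝ) - K) • posDev P X) ((K - (N 0 : ℝ)) • negDev P X) := by
  obtain ⟨hfinN, hleN⟩ := lintegral_stopTime_le hXs hR hN hI hfin
  set t := (∫⁻ ω, (lastTime R N Xs ω : ℝ≥0∞) ∂P).toReal with ht
  have hM := measurableSet_lt_lastTime (N := N) hXs hR
  obtain ⟨i1, e1⟩ := toReal_lintegral_enat hM hfin
  set m : Ω → ℕ := fun ω => (lastTime R N Xs ω).toNat with hm
  have hmm : Measurable m := Measurable.of_discrete.comp (measurable_enat hM)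
  have hmT : ∀ᵐ ω ∂P, (N 0 ≤ m ω ∧ m ω ≤ (stopTime R N Xs ω).toNat) ∧
      ((m ω : ℝ), partialSum Xs (m ω) ω) ∈ closure R := by
    filter_upwards [ae_ne_top hM hfin, hstart] with ω h h0
    rcases stopTime_lastTime_cases (R := R) (Xs := Xs) hN ω with ⟨-, h1, -⟩ | ⟨l, h1, h2, h3⟩
    · exact absurd h1 h
    · simp only [hm, h1, h2, ENat.toNat_natCast]
      refine ⟨⟨hN.monotone (Nat.zero_le l), hN.monotone (Nat.le_succ l)⟩, ?_⟩
      rcases l.eq_zero_or_pos with rfl | hl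
      · exact h0
      · exact subset_closure (h3 hl)
  have hcoord (j : Fin d) := integral_sum_range_bounds hXs hindep hident
    (g := fun x => x j - mean P X j) ((measurable_pi_apply j).sub_const _)
    ((hXint j).sub (integrable_const _))
    (by rw [integral_sub (hXint j) (integrable_const _)]; simp [mean])
    (measurableSet_lt_stopTime hR) hfinN hmm (hmT.mono fun ω h => h.1)
  have hsum (j : Fin d) (ω : Ω) : partialSum Xs (m ω) ω j
      = ∑ i ∈ Finset.range (m ω), (Xs i ω j - mean P X j) + m ω * mean P X j := by
    simp [partialSum, Finset.sum_sub_distrib]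
  have hSint (j : Fin d) : Integrable (fun ω => partialSum Xs (m ω) ω j) P := by
    simp_rw [hsum]
    exact (hcoord j).1.add (i1.mul_const _)
  have hSeq (j : Fin d) : ∫ ω, partialSum Xs (m ω) ω j ∂P
      = ∫ ω, ∑ i ∈ Finset.range (m ω), (Xs i ω j - mean P X j) ∂P + t * mean P X j := by
    simp_rw [hsum]
    rw [integral_add (hcoord j).1 (i1.mul_const _), integral_mul_const, e1]
  have hSint' : Integrable (fun ω => partialSum Xs (m ω) ω) P := Integrable.of_eval hSint
  refine ⟨∫ ω, partialSum Xs (m ω) ω ∂P, ?_, fun j => ?_, fun j => ?_⟩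
  · rw [ht, ← e1, ← integral_pair i1 hSint']
    exact hconv.integral_mem isClosed_closure (hmT.mono fun ω h => h.2) (i1.prodMk hSint')
  · have h := (hcoord j).2.1
    have hp : 0 ≤ posDev P X j := integral_nonneg fun ω => le_max_left _ _
    change _ * posDev P X j ≤ _ at h
    simp only [eval_integral hSint, hSeq, Pi.add_apply, Pi.smul_apply, Pi.sub_apply, smul_eq_mul]
    -- The bound (N_0 - E[N]) E[(X - μ)⁺] becomes affine in t on replacing E[N] by λt + K.
    linarith [mul_le_mul_of_nonneg_right hleN hp]
  · have h := (hcoord j).2.2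
    have hp : 0 ≤ negDev P X j := integral_nonneg fun ω => le_max_left _ _
    change _ ≤ _ * negDev P X j at h
    simp only [eval_integral hSint, hSeq, Pi.add_apply, Pi.smul_apply, smul_eq_mul]
    linarith [mul_le_mul_of_nonneg_right hleN hp]

/-! ### Geometry of the feasible set -/

lemma convex_feasibleSet (hconv : Convex ℝ (closure R)) (α β ζ η : Fin d → ℝ) :
    Convex ℝ (feasibleSet R α β ζ η) := by
  rintro p ⟨hp, hp1, hp2⟩ q ⟨hq, hq1, hq2⟩ a b ha hb hab
  refine ⟨hconv hp hq ha hb hab, fun j => ?_, fun j => ?_⟩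
  · have h1 := mul_le_mul_of_nonneg_left (hp1 j) ha
    have h2 := mul_le_mul_of_nonneg_left (hq1 j) hb
    simp only [Prod.fst_add, Prod.smul_fst, Prod.snd_add, Prod.smul_snd, Pi.add_apply,
      Pi.smul_apply, smul_eq_mul] at *
    have : ζ j = a * ζ j + b * ζ j := by rw [← add_mul, hab, one_mul]
    linarith
  · have h1 := mul_le_mul_of_nonneg_left (hp2 j) ha
    have h2 := mul_le_mul_of_nonneg_left (hq2 j) hb
    simp only [Prod.fst_add, Prod.smul_fst, Prod.snd_add, Prod.smul_snd, Pi.add_apply,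
      Pi.smul_apply, smul_eq_mul] at *
    have : η j = a * η j + b * η j := by rw [← add_mul, hab, one_mul]
    linarith

lemma isClosed_feasibleSet (α β ζ η : Fin d → ℝ) : IsClosed (feasibleSet R α β ζ η) :=
  isClosed_closure.inter
    ((isClosed_le ((continuous_fst.smul continuous_const).add continuous_const) continuous_snd).inter
      (isClosed_le continuous_snd ((continuous_fst.smul continuous_const).add continuous_const)))

/-- Once 0 ≤ t ≤ b, the two constraints confine every coordinate of s, so the closed feasible set
sits inside a box. -/
lemma isCompact_feasibleSet (hRpos : ∀ p ∈ R, 0 ≤ p.1) {α β ζ η : Fin d → ℝ}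
    (hb : BddAbove (Prod.fst '' feasibleSet R α β ζ η)) : IsCompact (feasibleSet R α β ζ η) := by
  obtain ⟨b, hb⟩ := hb
  have hpos : closure R ⊆ {p | 0 ≤ p.1} :=
    closure_minimal hRpos (isClosed_le continuous_const continuous_fst)
  refine (isCompact_Icc (a := ((0 : ℝ), fun j => -(b * |α j|) + ζ j))
    (b := (b, fun j => b * |β j| + η j))).of_isClosed_subset (isClosed_feasibleSet α β ζ η) ?_
  intro p hp
  have h0 : 0 ≤ p.1 := hpos hp.1
  have h1 : p.1 ≤ b := hb (Set.mem_image_of_mem _ hp)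
  refine ⟨⟨h0, fun j => ?_⟩, ⟨h1, fun j => ?_⟩⟩
  · have h2 : p.1 * α j + ζ j ≤ p.2 j := hp.2.1 j
    have h3 := mul_le_mul_of_nonneg_right h1 (abs_nonneg (α j))
    have h4 := mul_le_mul_of_nonneg_left (neg_abs_le (α j)) h0
    dsimp only
    linarith
  · have h2 : p.2 j ≤ p.1 * β j + η j := hp.2.2 j
    have h3 := mul_le_mul_of_nonneg_right h1 (abs_nonneg (β j))
    have h4 := mul_le_mul_of_nonneg_left (le_abs_self (β j)) h0
    dsimp only
    linarith

/-- If the closure of the continuity region contains the ray through the mean, then it contains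
feasible points with arbitrarily large time coordinate. -/
lemma mem_feasibleSet_of_ray {lam K t : ℝ} {n : ℕ} (ht : n - K ≤ lam * t)
    (hmem : (t, t • mean P X) ∈ closure R) :
    (t, t • mean P X) ∈
      feasibleSet R (mean P X - lam • posDev P X) (mean P X + lam • negDev P X)
        (((n : ℝ) - K) • posDev P X) ((K - (n : ℝ)) • negDev P X) := by
  refine ⟨hmem, fun j => ?_, fun j => ?_⟩
  · have hp : 0 ≤ posDev P X j := integral_nonneg fun ω => le_max_left _ _
    simp only [Pi.add_apply, Pi.smul_apply, Pi.sub_apply, smul_eq_mul]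
    linarith [mul_le_mul_of_nonneg_right ht hp]
  · have hp : 0 ≤ negDev P X j := integral_nonneg fun ω => le_max_left _ _
    simp only [Pi.add_apply, Pi.smul_apply, smul_eq_mul]
    linarith [mul_le_mul_of_nonneg_right ht hp]

end GeomStop

/-! ### The main theorem -/

theorem theorem10 {Ω : Type*} [MeasurableSpace Ω] (P : Measure Ω) [IsProbabilityMeasure P]
    (d : ℕ)
    -- the random vector `X` and its independent copies `X_1, X_2, …`
    (X : Ω → (Fin d → ℝ)) (hX : Measurable X)
    (Xs : ℕ → Ω → (Fin d → ℝ)) (hXs : ∀ i, Measurable (Xs i))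
    (hindep : iIndepFun Xs P) (hident : ∀ i, IdentDistrib (Xs i) X P P)
    -- the grid `0 ≤ N_0 < N_1 < …` and the continuity region
    (N : ℕ → ℕ) (hN : StrictMono N)
    (R : Set (ℝ × (Fin d → ℝ))) (hRmeas : MeasurableSet R) (hRpos : ∀ p ∈ R, 0 ≤ p.1)
    -- assumptions (I) to (VI)
    (lam K : ℝ) (hlam : 0 < lam)
    (hI : ∀ l, (N (l + 1) : ℝ) ≤ lam * N l + K)
    (hII : limsup (fun l => ((N (l + 1) - N l : ℕ) : ℝ≥0∞)) atTop < ⊤ ∨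
      1 < liminf (fun l => (N (l + 1) : ℝ≥0∞) / (N l : ℝ≥0∞)) atTop)
    (hIII : Convex ℝ (closure R) ∧ (0, 0) ∈ closure R)
    (hIV : ∀ᵐ ω ∂P, ((N 0 : ℝ), GeomStop.partialSum Xs (N 0) ω) ∈ closure R)
    (hV : ∃! m : ℝ, 0 < m ∧ (m, m • GeomStop.mean P X) ∈ frontier R)
    (hVI : ∀ i, Integrable (fun ω => |X ω i| ^ 3) P)
    -- the constants
    (α β ζ η : Fin d → ℝ)
    (hα : α = GeomStop.mean P X - lam • GeomStop.posDev P X)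
    (hβ : β = GeomStop.mean P X + lam • GeomStop.negDev P X)
    (hζ : ζ = ((N 0 : ℝ) - K) • GeomStop.posDev P X)
    (hη : η = (K - (N 0 : ℝ)) • GeomStop.negDev P X) :
    -- `E[M] ≤ sup t` over the feasible set, in `[0, ∞]`
    (∫⁻ ω, (GeomStop.lastTime R N Xs ω : ℝ≥0∞) ∂P
      ≤ ⨆ p ∈ GeomStop.feasibleSet R α β ζ η, ENNReal.ofReal p.1) ∧
    -- unless it is infinite, the supremum is an attained maximum
    (BddAbove (Prod.fst '' GeomStop.feasibleSet R α β ζ η) →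
      ∃ p ∈ GeomStop.feasibleSet R α β ζ η,
        IsMaxOn Prod.fst (GeomStop.feasibleSet R α β ζ η) p ∧
        ∫⁻ ω, (GeomStop.lastTime R N Xs ω : ℝ≥0∞) ∂P ≤ ENNReal.ofReal p.1) ∧
    -- the program is convex
    Convex ℝ (GeomStop.feasibleSet R α β ζ η) ∧
    -- `E[N] ≤ λ E[M] + K`
    ((∫⁻ ω, (GeomStop.stopTime R N Xs ω : ℝ≥0∞) ∂P : ℝ≥0∞) : EReal)
      ≤ (lam : EReal) * ((∫⁻ ω, (GeomStop.lastTime R N Xs ω : ℝ≥0∞) ∂P : ℝ≥0∞) : EReal)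
        + (K : EReal) := by
  subst hα hβ hζ hη
  have hX2 (i : Fin d) : MemLp (fun ω => X ω i) 2 P :=
    GeomStop.memLp_two_of_integrable_abs_pow_three ((measurable_pi_apply i).comp hX) (hVI i)
  have hX1 (i : Fin d) : Integrable (fun ω => X ω i) P := (hX2 i).integrable one_le_two
  have hmain : (∫⁻ ω, (GeomStop.lastTime R N Xs ω : ℝ≥0∞) ∂P ≠ ⊤) ∨
      ∀ t : ℝ, 0 < t → (t, t • GeomStop.mean P X) ∈ closure R := by
    by_contra! hcon
    obtain ⟨htop, t, ht, hout⟩ := hcon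
    exact (GeomStop.lintegral_lastTime_lt_top hXs hindep hident hN hIII.1 hIII.2 hIV hX2 ht
      hout).ne htop
  have hconv := GeomStop.convex_feasibleSet hIII.1
  have hexp : ((∫⁻ ω, (GeomStop.stopTime R N Xs ω : ℝ≥0∞) ∂P : ℝ≥0∞) : EReal)
      ≤ (lam : EReal) * ((∫⁻ ω, (GeomStop.lastTime R N Xs ω : ℝ≥0∞) ∂P : ℝ≥0∞) : EReal)
        + (K : EReal) := by
    by_cases hfin : ∫⁻ ω, (GeomStop.lastTime R N Xs ω : ℝ≥0∞) ∂P = ⊤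
    · rw [hfin, EReal.coe_ennreal_top, EReal.coe_mul_top_of_pos hlam, EReal.top_add_coe]
      exact le_top
    · obtain ⟨h1, h2⟩ := GeomStop.lintegral_stopTime_le hXs hRmeas hN hI hfin
      rw [← EReal.coe_ennreal_toReal h1, ← EReal.coe_ennreal_toReal hfin]
      exact_mod_cast h2
  by_cases hfin : ∫⁻ ω, (GeomStop.lastTime R N Xs ω : ℝ≥0∞) ∂P = ⊤
  · have hray := hmain.resolve_left (not_not.mpr hfin)
    have hunb (B : ℝ) : ∃ t ≥ B, (t, t • GeomStop.mean P X) ∈ GeomStop.feasibleSet R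
        (GeomStop.mean P X - lam • GeomStop.posDev P X)
        (GeomStop.mean P X + lam • GeomStop.negDev P X)
        (((N 0 : ℝ) - K) • GeomStop.posDev P X) ((K - (N 0 : ℝ)) • GeomStop.negDev P X) := by
      -- The 1 keeps t positive, as `hray` requires; the quotient gives N_0 - K ≤ λt, which makes
      -- the ray point feasible.
      refine ⟨max B (max 1 ((N 0 - K) / lam)), le_max_left _ _,
        GeomStop.mem_feasibleSet_of_ray ?_ (hray _ ?_)⟩
      · rw [← div_le_iff₀' hlam]
        exact (le_max_right _ _).trans (le_max_right _ _)
      · exact one_pos.trans_le ((le_max_left _ _).trans (le_max_right _ _))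
    refine ⟨?_, fun ⟨b, hb⟩ => ?_, hconv _ _ _ _, hexp⟩
    · refine le_top.trans_eq (Eq.symm (ENNReal.eq_top_of_forall_nnreal_le fun r => ?_))
      obtain ⟨t, ht, hmem⟩ := hunb r
      refine le_trans ?_ (le_iSup₂ (f := fun p _ => ENNReal.ofReal p.1) _ hmem)
      rw [← ENNReal.ofReal_coe_nnreal]
      exact ENNReal.ofReal_le_ofReal ht
    -- Here t is unbounded on the feasible set, so the attainment claim is vacuous.
    · obtain ⟨t, ht, hmem⟩ := hunb (b + 1)
      have : t ≤ b := hb (Set.mem_image_of_mem Prod.fst hmem)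
      linarith
  · obtain ⟨s, hs⟩ := GeomStop.exists_feasible_of_lintegral_lastTime_ne_top hXs hindep hident hN
      hRmeas hI hIII.1 hIV hX1 hfin
    refine ⟨?_, fun hb => ?_, hconv _ _ _ _, hexp⟩
    · refine le_trans ?_ (le_iSup₂ (f := fun p _ => ENNReal.ofReal p.1) _ hs)
      rw [ENNReal.ofReal_toReal hfin]
    · obtain ⟨p, hp, hmax⟩ := (GeomStop.isCompact_feasibleSet hRpos hb).exists_isMaxOn ⟨_, hs⟩
        continuous_fst.continuousOn
      refine ⟨p, hp, hmax, ?_⟩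
      rw [← ENNReal.ofReal_toReal hfin]
      exact ENNReal.ofReal_le_ofReal (hmax hs)
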